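/- Let $m$ be a positive integer and let $r\ge 2$ be a real number. Let $r_k:[0,1]\to\mathbb R$, $r_k(t)=\operatorname{sign}(\sin(2^k\pi t))$, $k\ge 1$, be the Rademacher functions. Then for every positive integer $n$ and every array $(a_{i_1,\dots,i_m})_{i_1,\dots,i_m=1}^n$ of real numbers, $$\Bigl(\sum_{i_1,\dots,i_m=1}^n |a_{i_1,\dots,i_m}|^r\Bigr)^{1/r}\le 2^{m/r}\int_{[0,1]^m}\Bigl|\sum_{i_1,\dots,i_m=1}^n r_{i_1}(t_1)\cdots r_{i_m}(t_m)\,a_{i_1,\dots,i_m}\Bigr|\,dt_1\cdots dt_m .$$ Moreover, the constant $2^{m/r}$ is optimal: if $C$ is a real number such that the inequality with $C$ in place of $2^{m/r}$ holds for all positive integers $n$ and all such real arrays, then $C\ge 2^{m/r}$. -/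

import Mathlib

/-- The Rademacher functions `r_k(t) = sign (sin (2 ^ k * π * t))`, of interest for `k ≥ 1` and
`t ∈ [0,1]`. -/
noncomputable def rademacher (k : ℕ) (t : ℝ) : ℝ :=
  Real.sign (Real.sin (2 ^ k * Real.pi * t))

/-- The Rademacher chaos `∑ r_{i_1}(t_1) ⋯ r_{i_m}(t_m) a_{i_1,…,i_m}` of a real array with
indices `1, …, n`; the element `j : Fin n` stands for the index `j + 1`. -/
noncomputable def rademacherChaos {m n : ℕ} (a : (Fin m → Fin n) → ℝ) (t : Fin m → ℝ) : ℝ :=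
  ∑ i : Fin m → Fin n, (∏ k : Fin m, rademacher ((i k : ℕ) + 1) (t k)) * a i

/-- The `ℓ_r` norm of the array `a` is at most `C` times the `L_1([0,1]^m)` norm of its
Rademacher chaos. -/
def KhinchinBound {m n : ℕ} (r C : ℝ) (a : (Fin m → Fin n) → ℝ) : Prop :=
  (∑ i : Fin m → Fin n, |a i| ^ r) ^ (1 / r) ≤
    C * ∫ t in Set.univ.pi (fun _ : Fin m => Set.Icc (0 : ℝ) 1), |rademacherChaos a t|

/-- The sign `1` or `-1` encoded by a Boolean. -/
def boolSign (b : Bool) : ℝ := if b then 1 else -1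

@[simp] lemma boolSign_true : boolSign true = 1 := rfl
@[simp] lemma boolSign_false : boolSign false = -1 := rfl

lemma boolSign_not (b : Bool) : boolSign (!b) = -boolSign b := by cases b <;> simp

lemma boolSign_mul_self (b : Bool) : boolSign b * boolSign b = 1 := by cases b <;> simp

lemma abs_boolSign (b : Bool) : |boolSign b| = 1 := by cases b <;> simp

/-- The average of a function over the discrete cube. -/
noncomputable def cubeAvg {n : ℕ} (f : (Fin n → Bool) → ℝ) : ℝ := (∑ x, f x) / 2 ^ n

lemma cubeAvg_zero (f : (Fin 0 → Bool) → ℝ) : cubeAvg f = f ![] := by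
  simp only [cubeAvg, Fintype.sum_unique, pow_zero, div_one]
  exact congrArg f (Subsingleton.elim _ _)

lemma sum_cube_succ {n : ℕ} {M : Type*} [AddCommMonoid M] (f : (Fin (n + 1) → Bool) → M) :
    ∑ x, f x = ∑ x, f (Fin.cons true x) + ∑ x, f (Fin.cons false x) := by
  rw [← (Fin.consEquiv (fun _ : Fin (n + 1) => Bool)).sum_comp, Fintype.sum_prod_type]
  simp [Fin.consEquiv]

lemma cubeAvg_succ {n : ℕ} (f : (Fin (n + 1) → Bool) → ℝ) :
    cubeAvg f = (cubeAvg (fun x => f (Fin.cons true x)) +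
      cubeAvg (fun x => f (Fin.cons false x))) / 2 := by
  simp only [cubeAvg, sum_cube_succ f]
  field_simp
  ring

section CubeAvg
variable {n : ℕ} (f g : (Fin n → Bool) → ℝ)

lemma cubeAvg_add : cubeAvg (fun x => f x + g x) = cubeAvg f + cubeAvg g := by
  simp [cubeAvg, Finset.sum_add_distrib, add_div]

lemma cubeAvg_sub : cubeAvg (fun x => f x - g x) = cubeAvg f - cubeAvg g := by
  simp [cubeAvg, Finset.sum_sub_distrib, sub_div]

lemma cubeAvg_const_mul (c : ℝ) : cubeAvg (fun x => c * f x) = c * cubeAvg f := by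
  simp [cubeAvg, ← Finset.mul_sum, mul_div_assoc]

lemma cubeAvg_const (c : ℝ) : cubeAvg (fun _ : Fin n → Bool => c) = c := by
  simp [cubeAvg]

lemma cubeAvg_sum {ι : Type*} (s : Finset ι) (F : ι → (Fin n → Bool) → ℝ) :
    cubeAvg (fun x => ∑ i ∈ s, F i x) = ∑ i ∈ s, cubeAvg (F i) := by
  simp only [cubeAvg, ← Finset.sum_div]
  rw [Finset.sum_comm]

variable {f g} in
lemma cubeAvg_mono (h : ∀ x, f x ≤ g x) : cubeAvg f ≤ cubeAvg g := by
  unfold cubeAvg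
  gcongr with x
  exact h x

variable {f} in
lemma cubeAvg_nonneg (h : ∀ x, 0 ≤ f x) : 0 ≤ cubeAvg f :=
  div_nonneg (Finset.sum_nonneg fun x _ => h x) (by positivity)

lemma abs_cubeAvg_le : |cubeAvg f| ≤ cubeAvg (fun x => |f x|) := by
  unfold cubeAvg
  rw [abs_div, abs_of_pos (by positivity : (0 : ℝ) < 2 ^ n)]
  gcongr
  exact Finset.abs_sum_le_sum_abs _ _

lemma cubeAvg_comp_equiv (e : (Fin n → Bool) ≃ (Fin n → Bool)) :
    cubeAvg (fun x => f (e x)) = cubeAvg f := by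
  simp only [cubeAvg, e.sum_comp]

end CubeAvg

/-- Flip one coordinate of a point of the cube. -/
def cubeFlip {n : ℕ} (k : Fin n) (x : Fin n → Bool) : Fin n → Bool :=
  Function.update x k (!x k)

lemma cubeFlip_involutive {n : ℕ} (k : Fin n) : Function.Involutive (cubeFlip k) := by
  intro x
  simp [cubeFlip]

lemma cubeFlip_zero_cons {n : ℕ} (b : Bool) (x : Fin n → Bool) :
    cubeFlip 0 (Fin.cons b x : Fin (n + 1) → Bool) = Fin.cons (!b) x := by
  simp [cubeFlip]

lemma cubeFlip_succ_cons {n : ℕ} (k : Fin n) (b : Bool) (x : Fin n → Bool) :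
    cubeFlip k.succ (Fin.cons b x : Fin (n + 1) → Bool) = Fin.cons b (cubeFlip k x) := by
  simp [cubeFlip, Fin.cons_update]

lemma cubeAvg_comp_flip {n : ℕ} (k : Fin n) (f : (Fin n → Bool) → ℝ) :
    cubeAvg (fun x => f (cubeFlip k x)) = cubeAvg f :=
  cubeAvg_comp_equiv f (cubeFlip_involutive k).toPerm

/-- The Dirichlet form of the discrete cube. -/
noncomputable def cubeEnergy {n : ℕ} (f : (Fin n → Bool) → ℝ) : ℝ :=
  ∑ k, cubeAvg (fun x => ((f x - f (cubeFlip k x)) / 2) ^ 2)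

/-- The variance of a function on the discrete cube. -/
noncomputable def cubeVar {n : ℕ} (f : (Fin n → Bool) → ℝ) : ℝ :=
  cubeAvg (fun x => f x ^ 2) - cubeAvg f ^ 2

lemma cubeEnergy_nonneg {n : ℕ} (f : (Fin n → Bool) → ℝ) : 0 ≤ cubeEnergy f :=
  Finset.sum_nonneg fun _ _ => cubeAvg_nonneg fun _ => sq_nonneg _

lemma cubeAvg_parallelogram {n : ℕ} (u v : (Fin n → Bool) → ℝ) :
    (cubeAvg (fun x => u x ^ 2) + cubeAvg (fun x => v x ^ 2)) / 2 =
      cubeAvg (fun x => ((u x + v x) / 2) ^ 2) + cubeAvg (fun x => ((u x - v x) / 2) ^ 2) := by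
  rw [← cubeAvg_add, ← cubeAvg_add, div_eq_inv_mul, ← cubeAvg_const_mul]
  congr 1; ext x; ring

lemma cubeEnergy_parallelogram {n : ℕ} (u v : (Fin n → Bool) → ℝ) :
    (cubeEnergy u + cubeEnergy v) / 2 =
      cubeEnergy (fun x => (u x + v x) / 2) + cubeEnergy (fun x => (u x - v x) / 2) := by
  simp only [cubeEnergy]
  rw [← Finset.sum_add_distrib, ← Finset.sum_add_distrib, Finset.sum_div]
  refine Finset.sum_congr rfl fun k _ => ?_
  rw [cubeAvg_parallelogram]
  congr 2 <;> (ext x; ring)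

lemma cubeEnergy_succ {n : ℕ} (f : (Fin (n + 1) → Bool) → ℝ) :
    cubeEnergy f =
      cubeAvg (fun x => ((f (Fin.cons true x) - f (Fin.cons false x)) / 2) ^ 2) +
      (cubeEnergy (fun x => f (Fin.cons true x)) + cubeEnergy (fun x => f (Fin.cons false x))) / 2 := by
  simp only [cubeEnergy]
  rw [Fin.sum_univ_succ, ← Finset.sum_add_distrib, Finset.sum_div]
  congr 1
  · rw [cubeAvg_succ]
    simp only [cubeFlip_zero_cons, Bool.not_true, Bool.not_false]
    rw [← cubeAvg_add, div_eq_inv_mul, ← cubeAvg_const_mul]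
    congr 1; ext x; ring
  · refine Finset.sum_congr rfl fun k _ => ?_
    rw [cubeAvg_succ]
    simp only [cubeFlip_succ_cons]

lemma cubeAvg_half_add {n : ℕ} (u v : (Fin n → Bool) → ℝ) :
    cubeAvg (fun x => (u x + v x) / 2) = (cubeAvg u + cubeAvg v) / 2 := by
  rw [← cubeAvg_add, div_eq_inv_mul, ← cubeAvg_const_mul]
  congr 1; ext x; ring

lemma cubeAvg_half_sub {n : ℕ} (u v : (Fin n → Bool) → ℝ) :
    cubeAvg (fun x => (u x - v x) / 2) = (cubeAvg u - cubeAvg v) / 2 := by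
  rw [← cubeAvg_sub, div_eq_inv_mul, ← cubeAvg_const_mul]
  congr 1; ext x; ring

lemma cubeVar_succ {n : ℕ} (f : (Fin (n + 1) → Bool) → ℝ) :
    cubeVar f = cubeVar (fun x => (f (Fin.cons true x) + f (Fin.cons false x)) / 2) +
      cubeAvg (fun x => ((f (Fin.cons true x) - f (Fin.cons false x)) / 2) ^ 2) := by
  simp only [cubeVar, cubeAvg_half_add]
  rw [cubeAvg_succ (fun x => f x ^ 2), cubeAvg_succ f, cubeAvg_parallelogram]
  ring

/-- The Poincaré inequality on the discrete cube. -/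
lemma cubeVar_le_cubeEnergy {n : ℕ} (f : (Fin n → Bool) → ℝ) : cubeVar f ≤ cubeEnergy f := by
  induction n with
  | zero => simp [cubeVar, cubeEnergy, cubeAvg_zero]
  | succ n ih =>
    rw [cubeVar_succ, cubeEnergy_succ, cubeEnergy_parallelogram]
    have h1 := ih fun x => (f (Fin.cons true x) + f (Fin.cons false x)) / 2
    have h2 := cubeEnergy_nonneg fun x => (f (Fin.cons true x) - f (Fin.cons false x)) / 2
    linarith

/-- The Poincaré inequality with constant two, up to the first order Walsh coefficients. -/
lemma two_mul_cubeVar_le {n : ℕ} (f : (Fin n → Bool) → ℝ) :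
    2 * cubeVar f ≤ cubeEnergy f + ∑ k, cubeAvg (fun x => boolSign (x k) * f x) ^ 2 := by
  induction n with
  | zero => simp [cubeVar, cubeEnergy, cubeAvg_zero]
  | succ n ih =>
    rw [cubeVar_succ, cubeEnergy_succ, cubeEnergy_parallelogram, Fin.sum_univ_succ]
    have h1 := ih fun x => (f (Fin.cons true x) + f (Fin.cons false x)) / 2
    have h2 := cubeVar_le_cubeEnergy
      fun x => (f (Fin.cons true x) - f (Fin.cons false x)) / 2
    have e0 : cubeAvg (fun x => boolSign (x 0) * f x) =
        cubeAvg (fun x => (f (Fin.cons true x) - f (Fin.cons false x)) / 2) := by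
      rw [cubeAvg_succ, cubeAvg_half_sub]
      simp only [Fin.cons_zero, boolSign_true, boolSign_false, cubeAvg_const_mul]
      ring
    have e1 : ∀ k : Fin n, cubeAvg (fun x => boolSign (x k.succ) * f x) =
        cubeAvg (fun x => boolSign (x k) * ((f (Fin.cons true x) + f (Fin.cons false x)) / 2)) := by
      intro k
      rw [cubeAvg_succ]
      simp only [Fin.cons_succ]
      rw [← cubeAvg_half_add]
      congr 1; ext x; ring
    simp only [e0, e1]
    simp only [cubeVar] at h1 h2 ⊢
    linarith

lemma cubeAvg_boolSign_mul_eq_zero {n : ℕ} {f : (Fin n → Bool) → ℝ}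
    (hf : ∀ x, f (fun i => !x i) = f x) (k : Fin n) :
    cubeAvg (fun x => boolSign (x k) * f x) = 0 := by
  have hinv : Function.Involutive (fun (x : Fin n → Bool) i => !x i) := fun x => by simp
  have h := cubeAvg_comp_equiv (fun x => boolSign (x k) * f x) hinv.toPerm
  simp only [Function.Involutive.coe_toPerm, hf, boolSign_not, neg_mul] at h
  have h2 := cubeAvg_const_mul (fun x => boolSign (x k) * f x) (-1)
  simp only [neg_mul, one_mul] at h2
  linarith

lemma cubeEnergy_eq {n : ℕ} (f : (Fin n → Bool) → ℝ) :
    cubeEnergy f = cubeAvg (fun x => f x * ∑ k, (f x - f (cubeFlip k x)) / 2) := by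
  simp only [Finset.mul_sum, cubeAvg_sum, cubeEnergy]
  refine Finset.sum_congr rfl fun k _ => ?_
  have h := cubeAvg_comp_flip k (fun x => f x ^ 2)
  have e : cubeAvg (fun x => ((f x - f (cubeFlip k x)) / 2) ^ 2) =
      cubeAvg (fun x => f x * ((f x - f (cubeFlip k x)) / 2)) +
      4⁻¹ * (cubeAvg (fun x => f (cubeFlip k x) ^ 2) - cubeAvg (fun x => f x ^ 2)) := by
    rw [← cubeAvg_sub, ← cubeAvg_const_mul, ← cubeAvg_add]
    congr 1; ext x; ring
  rw [e, h]; ring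

/-- The Rademacher sum `∑ ε_i b_i`. -/
noncomputable def signSum {n : ℕ} (b : Fin n → ℝ) (x : Fin n → Bool) : ℝ :=
  ∑ i, boolSign (x i) * b i

lemma signSum_not {n : ℕ} (b : Fin n → ℝ) (x : Fin n → Bool) :
    signSum b (fun i => !x i) = -signSum b x := by
  simp [signSum, boolSign_not]

lemma signSum_cubeFlip {n : ℕ} (b : Fin n → ℝ) (x : Fin n → Bool) (k : Fin n) :
    signSum b (cubeFlip k x) = signSum b x - 2 * (boolSign (x k) * b k) := by
  have h : ∀ i, boolSign (cubeFlip k x i) * b i =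
      boolSign (x i) * b i - if i = k then 2 * (boolSign (x k) * b k) else 0 := by
    intro i
    by_cases hi : i = k
    · subst hi
      simp [cubeFlip, boolSign_not]; ring
    · simp [cubeFlip, hi]
  simp [signSum, h, Finset.sum_sub_distrib]

lemma sum_abs_signSum_sub_le {n : ℕ} (b : Fin n → ℝ) (x : Fin n → Bool) :
    ∑ k, (|signSum b x| - |signSum b (cubeFlip k x)|) / 2 ≤ |signSum b x| := by
  have h1 : |∑ k, signSum b (cubeFlip k x)| ≤ ∑ k, |signSum b (cubeFlip k x)| :=
    Finset.abs_sum_le_sum_abs _ _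
  have h2 : ∑ k, signSum b (cubeFlip k x) = (n - 2) * signSum b x := by
    simp only [signSum_cubeFlip, Finset.sum_sub_distrib, ← Finset.mul_sum]
    simp only [Finset.sum_const, Finset.card_univ, Fintype.card_fin, nsmul_eq_mul]
    change (n : ℝ) * signSum b x - 2 * signSum b x = _
    ring
  rw [h2, abs_mul] at h1
  have h3 := mul_le_mul_of_nonneg_right (le_abs_self ((n : ℝ) - 2)) (abs_nonneg (signSum b x))
  rw [← Finset.sum_div, Finset.sum_sub_distrib]
  simp only [Finset.sum_const, Finset.card_univ, Fintype.card_fin, nsmul_eq_mul]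
  linarith

lemma cubeAvg_boolSign_mul_boolSign {n : ℕ} (i j : Fin n) :
    cubeAvg (fun x => boolSign (x i) * boolSign (x j)) = if i = j then 1 else 0 := by
  split_ifs with h
  · subst h
    simp [boolSign_mul_self, cubeAvg_const]
  · have h1 := cubeAvg_comp_flip i (fun x => boolSign (x i) * boolSign (x j))
    have h2 := cubeAvg_const_mul (fun x => boolSign (x i) * boolSign (x j)) (-1)
    simp only [cubeFlip, Function.update_self, Function.update_of_ne (Ne.symm h), boolSign_not,
      neg_mul] at h1
    simp only [neg_mul, one_mul] at h2
    linarith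

lemma cubeAvg_boolSign_mul_signSum {n : ℕ} (b : Fin n → ℝ) (j : Fin n) :
    cubeAvg (fun x => boolSign (x j) * signSum b x) = b j := by
  have : ∀ x : Fin n → Bool, boolSign (x j) * signSum b x =
      ∑ i, b i * (boolSign (x j) * boolSign (x i)) := by
    intro x
    rw [signSum, Finset.mul_sum]
    exact Finset.sum_congr rfl fun i _ => by ring
  simp only [this, cubeAvg_sum, cubeAvg_const_mul, cubeAvg_boolSign_mul_boolSign]
  simp

lemma abs_le_cubeAvg_abs_signSum {n : ℕ} (b : Fin n → ℝ) (j : Fin n) :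
    |b j| ≤ cubeAvg (fun x => |signSum b x|) := by
  rw [← cubeAvg_boolSign_mul_signSum b j]
  refine (abs_cubeAvg_le _).trans_eq ?_
  simp [abs_mul, abs_boolSign]

lemma cubeAvg_signSum_sq {n : ℕ} (b : Fin n → ℝ) :
    cubeAvg (fun x => signSum b x ^ 2) = ∑ i, b i ^ 2 := by
  have : ∀ x : Fin n → Bool, signSum b x ^ 2 = ∑ i, b i * (boolSign (x i) * signSum b x) := by
    intro x
    rw [sq]
    nth_rw 1 [signSum]
    rw [Finset.sum_mul]
    exact Finset.sum_congr rfl fun i _ => by ring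
  simp only [this, cubeAvg_sum, cubeAvg_const_mul, cubeAvg_boolSign_mul_signSum, sq]

/-- The Khinchin inequality between `L_1` and `L_2` with Szarek's constant. -/
theorem sum_sq_le_two_mul_cubeAvg_sq {n : ℕ} (b : Fin n → ℝ) :
    ∑ i, b i ^ 2 ≤ 2 * cubeAvg (fun x => |signSum b x|) ^ 2 := by
  have h1 := two_mul_cubeVar_le (fun x => |signSum b x|)
  have h2 : ∑ k, cubeAvg (fun x => boolSign (x k) * |signSum b x|) ^ 2 = 0 := by
    refine Finset.sum_eq_zero fun k _ => ?_
    rw [cubeAvg_boolSign_mul_eq_zero (f := fun x => |signSum b x|) (fun x => ?_) k]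
    · simp
    · simp [signSum_not]
  have h3 : cubeEnergy (fun x => |signSum b x|) ≤ ∑ i, b i ^ 2 := by
    rw [cubeEnergy_eq, ← cubeAvg_signSum_sq]
    refine cubeAvg_mono fun x => ?_
    rw [← sq_abs, sq]
    exact mul_le_mul_of_nonneg_left (sum_abs_signSum_sub_le b x) (abs_nonneg _)
  simp only [cubeVar, sq_abs, cubeAvg_signSum_sq] at h1
  linarith

theorem sqrt_sum_sq_le_cubeAvg {n : ℕ} (b : Fin n → ℝ) :
    √(∑ i, b i ^ 2) ≤ √2 * cubeAvg (fun x => |signSum b x|) := by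
  refine Real.sqrt_le_iff.2 ⟨mul_nonneg (by positivity) (cubeAvg_nonneg fun _ => abs_nonneg _), ?_⟩
  rw [mul_pow, Real.sq_sqrt (by norm_num)]
  exact sum_sq_le_two_mul_cubeAvg_sq b

/-- The average of a function over a power of the discrete cube. -/
noncomputable def multiAvg {m n : ℕ} (F : (Fin m → Fin n → Bool) → ℝ) : ℝ :=
  (∑ e, F e) / (2 ^ n) ^ m

/-- The chaos `∑ ε^1_{i_1} ⋯ ε^m_{i_m} a_{i_1,…,i_m}` on a power of the discrete cube. -/
noncomputable def cubeChaos {m n : ℕ} (a : (Fin m → Fin n) → ℝ) (e : Fin m → Fin n → Bool) : ℝ :=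
  ∑ i, (∏ k, boolSign (e k (i k))) * a i

lemma sum_fin_succ_pi {m : ℕ} {α M : Type*} [Fintype α] [AddCommMonoid M]
    (f : (Fin (m + 1) → α) → M) : ∑ i, f i = ∑ x, ∑ i, f (Fin.cons x i) := by
  rw [← (Fin.consEquiv (fun _ : Fin (m + 1) => α)).sum_comp, Fintype.sum_prod_type]
  rfl

lemma multiAvg_succ {m n : ℕ} (F : (Fin (m + 1) → Fin n → Bool) → ℝ) :
    multiAvg F = multiAvg (fun e => cubeAvg (fun x => F (Fin.cons x e))) := by
  simp only [multiAvg, cubeAvg]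
  rw [sum_fin_succ_pi, Finset.sum_comm, ← Finset.sum_div, div_div, pow_succ']

lemma multiAvg_mono {m n : ℕ} {F G : (Fin m → Fin n → Bool) → ℝ} (h : ∀ e, F e ≤ G e) :
    multiAvg F ≤ multiAvg G := by
  unfold multiAvg
  gcongr with e
  exact h e

lemma multiAvg_nonneg {m n : ℕ} {F : (Fin m → Fin n → Bool) → ℝ} (h : ∀ e, 0 ≤ F e) :
    0 ≤ multiAvg F :=
  div_nonneg (Finset.sum_nonneg fun e _ => h e) (by positivity)

lemma multiAvg_const_mul {m n : ℕ} (F : (Fin m → Fin n → Bool) → ℝ) (c : ℝ) :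
    multiAvg (fun e => c * F e) = c * multiAvg F := by
  simp [multiAvg, ← Finset.mul_sum, mul_div_assoc]

lemma cubeChaos_cons {m n : ℕ} (a : (Fin (m + 1) → Fin n) → ℝ) (x : Fin n → Bool)
    (e : Fin m → Fin n → Bool) :
    cubeChaos a (Fin.cons x e) = signSum (fun j => cubeChaos (fun i => a (Fin.cons j i)) e) x := by
  simp only [cubeChaos, signSum]
  rw [sum_fin_succ_pi]
  simp only [Fin.prod_univ_succ, Fin.cons_zero, Fin.cons_succ, Finset.mul_sum, mul_assoc]

/-- Minkowski's inequality for the averages of finitely many functions. -/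
lemma sqrt_sum_multiAvg_sq_le {m n : ℕ} {ι : Type*} [Fintype ι]
    (F : ι → (Fin m → Fin n → Bool) → ℝ) :
    √(∑ j, multiAvg (F j) ^ 2) ≤ multiAvg (fun e => √(∑ j, F j e ^ 2)) := by
  have h := norm_sum_le (Finset.univ : Finset (Fin m → Fin n → Bool))
    (fun e => WithLp.toLp 2 (fun j => F j e))
  simp only [EuclideanSpace.norm_eq, Real.norm_eq_abs, sq_abs, WithLp.ofLp_sum,
    Finset.sum_apply] at h
  simp only [multiAvg, div_pow]
  rw [← Finset.sum_div, Real.sqrt_div (by positivity), Real.sqrt_sq (by positivity)]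
  gcongr

lemma abs_le_multiAvg_cubeChaos {m n : ℕ} (a : (Fin m → Fin n) → ℝ) (i : Fin m → Fin n) :
    |a i| ≤ multiAvg (fun e => |cubeChaos a e|) := by
  induction m with
  | zero => simp [multiAvg, cubeChaos, Subsingleton.elim i default]
  | succ m ih =>
    rw [multiAvg_succ]
    have h := ih (fun i' => a (Fin.cons (i 0) i')) (Fin.tail i)
    rw [Fin.cons_self_tail] at h
    refine h.trans (multiAvg_mono fun e => ?_)
    simp only [cubeChaos_cons]
    exact abs_le_cubeAvg_abs_signSum (fun j => cubeChaos (fun i => a (Fin.cons j i)) e) (i 0)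

lemma sqrt_sum_sq_le_multiAvg {m n : ℕ} (a : (Fin m → Fin n) → ℝ) :
    √(∑ i, a i ^ 2) ≤ √2 ^ m * multiAvg (fun e => |cubeChaos a e|) := by
  induction m with
  | zero => simp [multiAvg, cubeChaos, Real.sqrt_sq_eq_abs]
  | succ m ih =>
    calc √(∑ i, a i ^ 2)
        = √(∑ j, √(∑ i : Fin m → Fin n, a (Fin.cons j i) ^ 2) ^ 2) := by
          rw [sum_fin_succ_pi]
          congr 1
          refine Finset.sum_congr rfl fun j _ => ?_
          rw [Real.sq_sqrt (Finset.sum_nonneg fun _ _ => sq_nonneg _)]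
      _ ≤ √(∑ j, (√2 ^ m * multiAvg (fun e => |cubeChaos (fun i => a (Fin.cons j i)) e|)) ^ 2) := by
          gcongr with j
          exact ih _
      _ = √2 ^ m * √(∑ j, multiAvg (fun e => |cubeChaos (fun i => a (Fin.cons j i)) e|) ^ 2) := by
          simp only [mul_pow _ _ 2, ← Finset.mul_sum]
          rw [Real.sqrt_mul (by positivity), Real.sqrt_sq (by positivity)]
      _ ≤ √2 ^ m * multiAvg (fun e => √(∑ j, |cubeChaos (fun i => a (Fin.cons j i)) e| ^ 2)) := by
          gcongr
          exact sqrt_sum_multiAvg_sq_le _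
      _ ≤ √2 ^ m * multiAvg (fun e => √2 * cubeAvg (fun x => |cubeChaos a (Fin.cons x e)|)) := by
          gcongr
          refine multiAvg_mono fun e => ?_
          simp only [sq_abs, cubeChaos_cons]
          exact sqrt_sum_sq_le_cubeAvg _
      _ = √2 ^ (m + 1) * multiAvg (fun e => |cubeChaos a e|) := by
          rw [multiAvg_const_mul, multiAvg_succ (fun e => |cubeChaos a e|), pow_succ, mul_assoc]

lemma rpow_sum_le_multiAvg {m n : ℕ} {r : ℝ} (hr : 2 ≤ r) (a : (Fin m → Fin n) → ℝ) :
    (∑ i, |a i| ^ r) ^ (1 / r) ≤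
      (2 : ℝ) ^ ((m : ℝ) / r) * multiAvg (fun e => |cubeChaos a e|) := by
  set M := multiAvg (fun e => |cubeChaos a e|) with hM
  have hM0 : 0 ≤ M := multiAvg_nonneg fun _ => abs_nonneg _
  have hr0 : 0 < r := by linarith
  have h2 : ∑ i, a i ^ 2 ≤ 2 ^ m * M ^ 2 := by
    have h := (Real.sqrt_le_left (by positivity)).1 (sqrt_sum_sq_le_multiAvg a)
    rwa [mul_pow, ← pow_mul, mul_comm m 2, pow_mul, Real.sq_sqrt (by norm_num)] at h
  have hpow : ∀ x : ℝ, 0 ≤ x → x ^ r = x ^ (r - 2) * x ^ 2 := by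
    intro x hx
    rw [← Real.rpow_natCast x 2, ← Real.rpow_add_of_nonneg hx (by linarith) (by norm_num)]
    norm_num
  have key : ∑ i, |a i| ^ r ≤ 2 ^ m * M ^ r := by
    calc ∑ i, |a i| ^ r ≤ ∑ i, M ^ (r - 2) * a i ^ 2 := by
          refine Finset.sum_le_sum fun i _ => ?_
          rw [hpow _ (abs_nonneg _), sq_abs]
          gcongr
          exact abs_le_multiAvg_cubeChaos a i
      _ ≤ M ^ (r - 2) * (2 ^ m * M ^ 2) := by
          rw [← Finset.mul_sum]
          gcongr
      _ = 2 ^ m * M ^ r := by rw [hpow M hM0]; ring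
  calc (∑ i, |a i| ^ r) ^ (1 / r) ≤ (2 ^ m * M ^ r) ^ (1 / r) := by
        gcongr
    _ = _ := by
        rw [Real.mul_rpow (by positivity) (by positivity), ← Real.rpow_natCast 2 m,
          ← Real.rpow_mul (by norm_num), ← Real.rpow_mul hM0, mul_one_div, mul_one_div,
          div_self hr0.ne', Real.rpow_one]

lemma cubeChaos_one {m n : ℕ} (e : Fin m → Fin n → Bool) :
    cubeChaos (fun _ => 1) e = ∏ k, ∑ j, boolSign (e k j) := by
  simp [cubeChaos, Finset.prod_univ_sum]

lemma multiAvg_abs_cubeChaos_one_fin_two (m : ℕ) :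
    multiAvg (fun e : Fin m → Fin 2 → Bool => |cubeChaos (fun _ => 1) e|) = 1 := by
  simp only [cubeChaos_one, Finset.abs_prod, multiAvg]
  have h := Finset.prod_univ_sum (fun _ : Fin m => (Finset.univ : Finset (Fin 2 → Bool)))
    (fun _ x => |∑ j, boolSign (x j)|)
  rw [Fintype.piFinset_univ] at h
  rw [← h]
  have : ∑ x : Fin 2 → Bool, |∑ j, boolSign (x j)| = 2 ^ 2 := by
    rw [sum_cube_succ, sum_cube_succ, sum_cube_succ]
    norm_num [Fin.sum_univ_two]
  rw [this, Finset.prod_const]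
  simp

section Integral

open MeasureTheory Set

/-- The binary digits of a point, encoded by the positivity of the Rademacher functions. -/
noncomputable def rademacherBits (n : ℕ) (t : ℝ) (k : Fin n) : Bool :=
  decide (0 < Real.sin (2 ^ ((k : ℕ) + 1) * Real.pi * t))

lemma measurable_rademacherBits (n : ℕ) : Measurable (rademacherBits n) := by
  refine measurable_pi_lambda _ fun k => ?_
  refine measurable_to_bool ?_
  have : (fun t => rademacherBits n t k) ⁻¹' {true} =
      {t | 0 < Real.sin (2 ^ ((k : ℕ) + 1) * Real.pi * t)} := by
    ext t; simp [rademacherBits]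
  rw [this]
  exact measurableSet_lt measurable_const (by fun_prop)

lemma rademacherBits_add_one (n : ℕ) (t : ℝ) :
    rademacherBits n (t + 1) = rademacherBits n t := by
  funext k
  have h : (2 : ℝ) ^ ((k : ℕ) + 1) * Real.pi * (t + 1) =
      2 ^ ((k : ℕ) + 1) * Real.pi * t + ((2 ^ (k : ℕ) : ℕ) : ℝ) * (2 * Real.pi) := by
    push_cast; ring
  simp only [rademacherBits, h, Real.sin_add_nat_mul_two_pi]

lemma rademacherBits_succ (n : ℕ) (t : ℝ) :
    rademacherBits (n + 1) t =
      Fin.cons (decide (0 < Real.sin (2 * Real.pi * t))) (rademacherBits n (2 * t)) := by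
  funext k
  refine Fin.cases ?_ (fun k => ?_) k
  · simp [rademacherBits]
  · simp only [rademacherBits, Fin.cons_succ, Fin.val_succ]
    congr 3
    ring

lemma intervalIntegrable_comp_rademacherBits {n : ℕ} (F : (Fin n → Bool) → ℝ) (c a b : ℝ) :
    IntervalIntegrable (fun t => F (rademacherBits n (c * t))) volume a b := by
  refine (intervalIntegrable_const (c := ∑ x, |F x|)).mono_fun ?_ ?_
  · exact ((measurable_of_finite F).comp ((measurable_rademacherBits n).comp
      (measurable_const_mul c))).aestronglyMeasurable
  · refine ae_of_all _ fun t => ?_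
    rw [Real.norm_eq_abs]
    exact (Finset.single_le_sum (f := fun x => |F x|) (fun _ _ => abs_nonneg _)
      (Finset.mem_univ _)).trans (le_abs_self _)

lemma integral_comp_rademacherBits {n : ℕ} (F : (Fin n → Bool) → ℝ) :
    ∫ t in (0 : ℝ)..1, F (rademacherBits n t) = cubeAvg F := by
  induction n with
  | zero =>
    have : ∀ t, F (rademacherBits 0 t) = F ![] := fun t => congrArg F (Subsingleton.elim _ _)
    simp [this, cubeAvg_zero]
  | succ n ih =>
    have hint := intervalIntegrable_comp_rademacherBits F 1
    simp only [one_mul] at hint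
    rw [← intervalIntegral.integral_add_adjacent_intervals (hint 0 (1 / 2)) (hint (1 / 2) 1)]
    have h1 : ∫ t in (0 : ℝ)..1 / 2, F (rademacherBits (n + 1) t) =
        ∫ t in (0 : ℝ)..1 / 2, F (Fin.cons true (rademacherBits n (2 * t))) := by
      refine intervalIntegral.integral_congr_Ioo_of_le (by norm_num) fun t ht => ?_
      have : 0 < Real.sin (2 * Real.pi * t) :=
        Real.sin_pos_of_pos_of_lt_pi (by have := ht.1; positivity)
          (by nlinarith [ht.2, Real.pi_pos])
      simp [rademacherBits_succ, this]
    have h2 : ∫ t in (1 / 2 : ℝ)..1, F (rademacherBits (n + 1) t) =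
        ∫ t in (1 / 2 : ℝ)..1, F (Fin.cons false (rademacherBits n (2 * t))) := by
      refine intervalIntegral.integral_congr_Ioo_of_le (by norm_num) fun t ht => ?_
      have : ¬ 0 < Real.sin (2 * Real.pi * t) := by
        rw [← Real.sin_sub_two_pi, not_lt]
        exact Real.sin_nonpos_of_nonpos_of_neg_pi_le (by nlinarith [ht.2, Real.pi_pos])
          (by nlinarith [ht.1, Real.pi_pos])
      simp [rademacherBits_succ, this]
    rw [h1, h2,
      intervalIntegral.integral_comp_mul_left (fun s => F (Fin.cons true (rademacherBits n s)))
        two_ne_zero,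
      intervalIntegral.integral_comp_mul_left (fun s => F (Fin.cons false (rademacherBits n s)))
        two_ne_zero, cubeAvg_succ, ← ih, ← ih]
    have h3 : ∫ s in (2 * (1 / 2) : ℝ)..2 * 1, F (Fin.cons false (rademacherBits n s)) =
        ∫ s in (0 : ℝ)..1, F (Fin.cons false (rademacherBits n s)) := by
      have := intervalIntegral.integral_comp_add_right (a := 0) (b := 1)
        (fun s => F (Fin.cons false (rademacherBits n s))) 1
      simp only [rademacherBits_add_one] at this
      rw [this]; norm_num
    rw [h3]
    norm_num
    ring

lemma measureReal_map_rademacherBits_singleton (n : ℕ) (x : Fin n → Bool) :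
    ((volume.restrict (Icc (0 : ℝ) 1)).map (rademacherBits n)).real {x} = (2 ^ n)⁻¹ := by
  have hm := measurable_rademacherBits n
  rw [map_measureReal_apply hm (measurableSet_singleton x)]
  have h := integral_comp_rademacherBits (fun y => if y = x then (1 : ℝ) else 0)
  rw [intervalIntegral.integral_of_le zero_le_one, ← integral_Icc_eq_integral_Ioc] at h
  have e : (fun t => if rademacherBits n t = x then (1 : ℝ) else 0) =
      (rademacherBits n ⁻¹' {x}).indicator 1 := by
    ext t; simp [indicator]
  rw [e, integral_indicator_one (hm (measurableSet_singleton x))] at h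
  rw [h, cubeAvg]
  simp

lemma ae_sin_ne_zero (k : ℕ) : ∀ᵐ t : ℝ, Real.sin (2 ^ k * Real.pi * t) ≠ 0 := by
  have hc : (range fun z : ℤ => (z : ℝ) / 2 ^ k).Countable := countable_range _
  filter_upwards [hc.ae_notMem volume] with t ht h
  obtain ⟨z, hz⟩ := Real.sin_eq_zero_iff.1 h
  refine ht ⟨z, ?_⟩
  have : (z : ℝ) = 2 ^ k * t := by
    apply mul_right_cancel₀ Real.pi_ne_zero
    linarith
  simp only [this]
  field_simp

lemma ae_rademacher_eq (n : ℕ) :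
    ∀ᵐ t : ℝ, ∀ k : Fin n, rademacher ((k : ℕ) + 1) t = boolSign (rademacherBits n t k) := by
  refine ae_all_iff.2 fun k => ?_
  filter_upwards [ae_sin_ne_zero ((k : ℕ) + 1)] with t ht
  rcases lt_or_gt_of_ne ht with h | h
  · simp [rademacher, rademacherBits, Real.sign_of_neg h, not_lt.2 h.le]
  · simp [rademacher, rademacherBits, Real.sign_of_pos h, h]

theorem integral_abs_rademacherChaos {m n : ℕ} (a : (Fin m → Fin n) → ℝ) :
    ∫ t in univ.pi (fun _ : Fin m => Icc (0 : ℝ) 1), |rademacherChaos a t| =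
      multiAvg (fun e => |cubeChaos a e|) := by
  set μ : Measure ℝ := volume.restrict (Icc (0 : ℝ) 1) with hμ
  have hm := measurable_rademacherBits n
  have hbits : Measurable (fun (t : Fin m → ℝ) k => rademacherBits n (t k)) := by fun_prop
  have hae : ∀ᵐ t ∂Measure.pi (fun _ : Fin m => μ),
      |rademacherChaos a t| = |cubeChaos a (fun k => rademacherBits n (t k))| := by
    have h : ∀ᵐ t ∂Measure.pi (fun _ : Fin m => μ), ∀ k, ∀ j : Fin n,
        rademacher ((j : ℕ) + 1) (t k) = boolSign (rademacherBits n (t k) j) :=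
      ae_all_iff.2 fun k => (Measure.tendsto_eval_ae_ae (μ := fun _ : Fin m => μ)).eventually
        (ae_restrict_of_ae (ae_rademacher_eq n))
    filter_upwards [h] with t ht
    simp only [rademacherChaos, cubeChaos, ht]
  rw [volume_pi, Measure.restrict_pi_pi, integral_congr_ae hae,
    ← integral_map (φ := fun (t : Fin m → ℝ) k => rademacherBits n (t k))
      (f := fun e => |cubeChaos a e|) hbits.aemeasurable
      (measurable_of_finite _).aestronglyMeasurable,
    Measure.pi_map_pi (fun _ => hm.aemeasurable), integral_fintype .of_finite]
  have hs : ∀ e : Fin m → Fin n → Bool,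
      (Measure.pi (fun _ : Fin m => μ.map (rademacherBits n))).real {e} = ((2 ^ n) ^ m)⁻¹ := by
    intro e
    rw [← univ_pi_singleton, measureReal_def, Measure.pi_pi, ENNReal.toReal_prod]
    simp only [← measureReal_def, hμ, measureReal_map_rademacherBits_singleton]
    simp
  simp only [hs, smul_eq_mul, ← Finset.mul_sum, multiAvg]
  rw [div_eq_inv_mul]

end Integral

theorem proposition4p1 (m : ℕ) (hm : 1 ≤ m) (r : ℝ) (hr : 2 ≤ r) :
    (∀ n : ℕ, 1 ≤ n → ∀ a : (Fin m → Fin n) → ℝ, KhinchinBound r ((2 : ℝ) ^ ((m : ℝ) / r)) a) ∧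
    (∀ C : ℝ, (∀ n : ℕ, 1 ≤ n → ∀ a : (Fin m → Fin n) → ℝ, KhinchinBound r C a) →
      (2 : ℝ) ^ ((m : ℝ) / r) ≤ C) := by
  constructor
  · intro n _ a
    rw [KhinchinBound, integral_abs_rademacherChaos]
    exact rpow_sum_le_multiAvg hr a
  · intro C h
    have h2 := h 2 one_le_two fun _ => 1
    rw [KhinchinBound, integral_abs_rademacherChaos, multiAvg_abs_cubeChaos_one_fin_two,
      mul_one] at h2
    refine le_trans (le_of_eq ?_) h2
    simp only [abs_one, Real.one_rpow, Finset.sum_const, Finset.card_univ, Fintype.card_pi,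
      Fintype.card_fin, Finset.prod_const, nsmul_eq_mul, mul_one, Nat.cast_pow, Nat.cast_ofNat]
    rw [← Real.rpow_natCast 2 m, ← Real.rpow_mul (by norm_num), mul_one_div]
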